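/- Let $\mathbb{U}$ be the open unit disc and let $H^2$ be the Hardy space of $\mathbb{U}$, i.e. the Hilbert space of functions $f(z)=\sum_{n\ge 0}a_nz^n$ on $\mathbb{U}$ with $\|f\|^2=\sum_{n\ge 0}|a_n|^2<\infty$. Let $\varphi,\psi:\mathbb{U}\to\mathbb{C}$ be bounded holomorphic functions, and let $T_\varphi,T_\psi:H^2\to H^2$ be the analytic Toeplitz operators $T_\varphi f=\varphi f$ and $T_\psi f=\psi f$. A bounded linear operator $X$ on $H^2$ is said to intertwine $T_\varphi$ and $T_\psi$ if $XT_\varphi=T_\psi X$ and $X\neq 0$; write $T_\varphi\propto T_\psi$ if such an $X$ exists. Say that $\varphi$ singly covers a set $W$ if there is a set $V\subset\mathbb{U}$ that $\varphi$ maps injectively onto $W$ and such that $\varphi^{-1}(W)=V$. Theorem. Suppose that $\varphi$ singly covers a nonvoid open set $W\subset\varphi(\mathbb{U})$ with $W\cap\psi(\mathbb{U})\neq\emptyset$. If $T_\varphi\propto T_\psi$, then there is a holomorphic map $\omega:\mathbb{U}\to\mathbb{U}$ such that $\psi=\varphi\circ\omega$; in particular $\psi(\mathbb{U})\subset\varphi(\mathbb{U})$.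 Moreover, $\omega$ can be chosen so that every bounded operator $X$ on $H^2$ that intertwines $T_\varphi$ and $T_\psi$ is a weighted composition operator $X=C_{\omega,h}$ for some $h\in H^2$ (depending on $X$), that is, $Xf=h\cdot(f\circ\omega)$ for all $f\in H^2$. -/

import Mathlib

open scoped Complex.UnitDisc

/-- A function on the open unit disc `𝔻` is holomorphic: it is the restriction to the disc of a
function that is complex differentiable at the points of the disc. -/
def IsHolomorphic (f : 𝔻 → ℂ) : Prop :=
  ∃ F : ℂ → ℂ, DifferentiableOn ℂ F (Metric.ball 0 1) ∧ ∀ z : 𝔻, F z = f z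

/-- Bounded holomorphic functions on the unit disc. -/
def IsBoundedHolomorphic (φ : 𝔻 → ℂ) : Prop :=
  IsHolomorphic φ ∧ ∃ M : ℝ, ∀ z, ‖φ z‖ ≤ M

/-- `f` is the sum on the unit disc of the power series with coefficients `a`. -/
def HasTaylorCoeffs (f : 𝔻 → ℂ) (a : ℕ → ℂ) : Prop :=
  ∀ z : 𝔻, HasSum (fun n => a n * (z : ℂ) ^ n) (f z)

/-- On a circle of radius `r < 1`, the mean square of a convergent power series is the sum of the
squares of the moduli of its scaled coefficients. -/
theorem HasTaylorCoeffs.exists_lp {f : 𝔻 → ℂ} {a : ℕ → ℂ} (h : HasTaylorCoeffs f a)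
    (e : AddCircle (1 : ℝ) → 𝔻) (r : ℝ) (h0 : 0 ≤ r) (h1 : r < 1)
    (he : ∀ t, (e t : ℂ) = r * AddCircle.toCircle t) :
    ∃ g : MeasureTheory.Lp ℂ 2 (@AddCircle.haarAddCircle 1 _),
      (g =ᵐ[AddCircle.haarAddCircle] fun t => f (e t)) ∧
      HasSum (fun n => (‖a n‖ * r ^ n) ^ 2) (‖g‖ ^ 2) := by
  have hs : Summable (fun n => ‖a n‖ * r ^ n) := by
    have := (h (Complex.UnitDisc.mk r (by
      rw [Complex.norm_real, Real.norm_of_nonneg h0]; exact h1))).summable.norm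
    simpa [abs_of_nonneg h0] using this
  have hsC : Summable (fun n : ℕ => (a n * (r : ℂ) ^ n) • (fourier (n : ℤ) : C(AddCircle (1 : ℝ), ℂ))) := by
    refine Summable.of_norm ?_
    simpa [norm_smul, fourier_norm, abs_of_nonneg h0] using hs
  have hG := hsC.hasSum
  set G := ∑' n : ℕ, (a n * (r : ℂ) ^ n) • (fourier (n : ℤ) : C(AddCircle (1 : ℝ), ℂ)) with hGdef
  have hGt : ∀ t, G t = f (e t) := by
    intro t
    have h2 := hG.map (ContinuousMap.evalCLM ℂ t) (ContinuousMap.evalCLM ℂ t).continuous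
    refine h2.unique ?_
    convert h (e t) using 2 with n
    simp [he, mul_pow, mul_assoc, AddCircle.toCircle_nsmul]
  refine ⟨ContinuousMap.toLp (E := ℂ) 2 AddCircle.haarAddCircle ℂ G, ?_, ?_⟩
  · filter_upwards [ContinuousMap.coeFn_toLp (p := 2) (𝕜 := ℂ) AddCircle.haarAddCircle G] with t ht
    rw [ht, hGt]
  · have h3 := hG.map (ContinuousMap.toLp (E := ℂ) 2 (@AddCircle.haarAddCircle 1 _) ℂ)
      (ContinuousMap.toLp (E := ℂ) 2 (@AddCircle.haarAddCircle 1 _) ℂ).continuous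
    have h4 : Filter.Tendsto _ _ _ := h3
    have h5 := (h4.norm).pow 2
    refine Filter.Tendsto.congr (fun s => ?_) h5
    have ho : Orthonormal ℂ (fun n : ℕ => fourierLp (T := 1) 2 (n : ℤ)) :=
      orthonormal_fourier.comp _ Nat.cast_injective
    have h6 := ho.inner_sum (fun n => a n * (r : ℂ) ^ n) (fun n => a n * (r : ℂ) ^ n) s
    rw [inner_self_eq_norm_sq_to_K] at h6
    have h7 : ∀ n, (starRingEnd ℂ) (a n * (r : ℂ) ^ n) * (a n * (r : ℂ) ^ n)
        = (((‖a n‖ * r ^ n) ^ 2 : ℝ) : ℂ) := by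
      intro n
      rw [Complex.conj_mul']
      simp [abs_of_nonneg h0]
    simp only [h7] at h6
    simp only [Function.comp_def, map_smul]
    have h8 : ∀ n : ℕ, ContinuousMap.toLp (E := ℂ) 2 (@AddCircle.haarAddCircle 1 _) ℂ
        (fourier (n : ℤ)) = fourierLp (T := 1) 2 (n : ℤ) := fun n => rfl
    simp only [h8]
    apply Complex.ofReal_injective
    rw [Complex.ofReal_pow, Complex.ofReal_sum]
    exact h6

/-- The map from the disc circle of radius `r`, with parameter in `ℝ / ℤ`. -/
noncomputable def circleParam (r : ℝ) (h0 : 0 ≤ r) (h1 : r < 1) (t : AddCircle (1 : ℝ)) : 𝔻 :=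
  Complex.UnitDisc.mk (r * AddCircle.toCircle t) (by
    rw [norm_mul, Circle.norm_coe, Complex.norm_real, Real.norm_of_nonneg h0, mul_one]
    exact h1)

theorem HasTaylorCoeffs.unique {f : 𝔻 → ℂ} {a b : ℕ → ℂ} (ha : HasTaylorCoeffs f a)
    (hb : HasTaylorCoeffs f b) : a = b := by
  have h : HasTaylorCoeffs (fun _ => 0) (fun n => a n - b n) := by
    intro z
    simpa [sub_mul] using (ha z).sub (hb z)
  obtain ⟨g, hg, hs⟩ := h.exists_lp (circleParam (1 / 2) (by norm_num) (by norm_num)) (1 / 2)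
    (by norm_num) (by norm_num) (fun t => by simp [circleParam])
  have hg0 : g = 0 := by
    rw [MeasureTheory.Lp.eq_zero_iff_ae_eq_zero]
    exact hg
  rw [hg0, norm_zero, zero_pow two_ne_zero, hasSum_zero_iff_of_nonneg (fun n => by positivity)] at hs
  funext n
  have := congrFun hs n
  simpa [sub_eq_zero] using this

/-- A bounded holomorphic multiplier does not increase the square sum of the Taylor coefficients
by more than the square of its bound. -/
theorem HasTaylorCoeffs.exists_mul {φ f : 𝔻 → ℂ} (hφ : IsHolomorphic φ) {M : ℝ}
    (hM : ∀ z, ‖φ z‖ ≤ M) {a : ℕ → ℂ} (ha : HasTaylorCoeffs f a)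
    (hs : Summable fun n => ‖a n‖ ^ 2) :
    ∃ c : ℕ → ℂ, HasTaylorCoeffs (fun z => φ z * f z) c ∧ (Summable fun n => ‖c n‖ ^ 2) ∧
      ∑' n, ‖c n‖ ^ 2 ≤ M ^ 2 * ∑' n, ‖a n‖ ^ 2 := by
  have hM0 : 0 ≤ M := (norm_nonneg _).trans (hM 0)
  obtain ⟨Φ, hΦ, hΦφ⟩ := hφ
  obtain ⟨b, hb⟩ : ∃ b : ℕ → ℂ, HasTaylorCoeffs φ b := by
    refine ⟨fun n => (n.factorial : ℂ)⁻¹ * iteratedDeriv n Φ 0, fun z => ?_⟩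
    have := Complex.hasSum_taylorSeries_on_ball (c := 0) (r := 1) (by simpa using hΦ) (z := z)
      (by simpa using z.norm_lt_one)
    rw [← hΦφ]
    refine Eq.mp (congrArg (fun u => HasSum u (Φ z)) (funext fun n => ?_)) this
    simp only [sub_zero, smul_eq_mul]
    ring
  let c : ℕ → ℂ := fun n => ∑ p ∈ Finset.HasAntidiagonal.antidiagonal n, b p.1 * a p.2
  have hc : HasTaylorCoeffs (fun z => φ z * f z) c := by
    intro z
    have h1 := summable_norm_sum_mul_antidiagonal_of_summable_norm (hb z).summable.norm
      (ha z).summable.norm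
    have h2 := tsum_mul_tsum_eq_tsum_sum_antidiagonal_of_summable_norm (hb z).summable.norm
      (ha z).summable.norm
    rw [(hb z).tsum_eq, (ha z).tsum_eq] at h2
    have h3 := h1.of_norm.hasSum
    rw [← h2] at h3
    refine Eq.mp (congrArg (fun u => HasSum u (φ z * f z)) (funext fun n => ?_)) h3
    symm
    rw [Finset.sum_mul]
    refine Finset.sum_congr rfl fun p hp => ?_
    rw [← Finset.HasAntidiagonal.mem_antidiagonal.1 hp, pow_add]
    ring
  have key : ∀ s : Finset ℕ, ∑ n ∈ s, ‖c n‖ ^ 2 ≤ M ^ 2 * ∑' n, ‖a n‖ ^ 2 := by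
    intro s
    have hr : ∀ r : ℝ, 0 ≤ r → r < 1 →
        ∑ n ∈ s, (‖c n‖ * r ^ n) ^ 2 ≤ M ^ 2 * ∑' n, ‖a n‖ ^ 2 := by
      intro r h0 h1
      obtain ⟨g, hg, hgs⟩ := ha.exists_lp (circleParam r h0 h1) r h0 h1 (fun t => rfl)
      obtain ⟨k, hk, hks⟩ := hc.exists_lp (circleParam r h0 h1) r h0 h1 (fun t => rfl)
      have hle : ‖k‖ ≤ M * ‖g‖ := by
        refine MeasureTheory.Lp.norm_le_mul_norm_of_ae_le_mul ?_
        filter_upwards [hg, hk] with t h2 h3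
        rw [h2, h3, norm_mul]
        exact mul_le_mul_of_nonneg_right (hM _) (norm_nonneg _)
      calc ∑ n ∈ s, (‖c n‖ * r ^ n) ^ 2 ≤ ‖k‖ ^ 2 :=
            sum_le_hasSum s (fun n _ => by positivity) hks
        _ ≤ (M * ‖g‖) ^ 2 := by gcongr
        _ = M ^ 2 * ‖g‖ ^ 2 := by ring
        _ ≤ M ^ 2 * ∑' n, ‖a n‖ ^ 2 := by
            refine mul_le_mul_of_nonneg_left ?_ (by positivity)
            refine hasSum_le (fun n => ?_) hgs hs.hasSum
            have : ‖a n‖ * r ^ n ≤ ‖a n‖ :=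
              mul_le_of_le_one_right (norm_nonneg _) (pow_le_one₀ h0 h1.le)
            gcongr
    have ht : Filter.Tendsto (fun r : ℝ => ∑ n ∈ s, (‖c n‖ * r ^ n) ^ 2) (nhdsWithin 1 (Set.Iio 1))
        (nhds (∑ n ∈ s, (‖c n‖ * 1 ^ n) ^ 2)) :=
      (Continuous.tendsto (by fun_prop) 1).mono_left nhdsWithin_le_nhds
    have := le_of_tendsto ht (b := M ^ 2 * ∑' n, ‖a n‖ ^ 2) (by
      filter_upwards [Ioo_mem_nhdsLT (show (0 : ℝ) < 1 by norm_num)] with r hr'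
      exact hr r hr'.1.le hr'.2)
    simpa using this
  exact ⟨c, hc, summable_of_sum_le (fun n => by positivity) key,
    Real.tsum_le_of_sum_le (fun n => by positivity) key⟩

/-- The functions on the unit disc that belong to the Hardy space `H²`: the sums of power series
with square-summable coefficients. -/
def hardySubmodule : Submodule ℂ (𝔻 → ℂ) where
  carrier := {f | ∃ a : ℕ → ℂ, HasTaylorCoeffs f a ∧ Summable fun n => ‖a n‖ ^ 2}
  zero_mem' := ⟨0, fun z => by simp [hasSum_zero], by simp [summable_zero]⟩
  add_mem' := by
    rintro f g ⟨a, ha, hsa⟩ ⟨b, hb, hsb⟩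
    refine ⟨fun n => a n + b n, fun z => ?_, ?_⟩
    · simpa [add_mul] using (ha z).add (hb z)
    · have h := (memℓp_gen (p := 2) (f := a) (by simpa using hsa)).add
        (memℓp_gen (p := 2) (f := b) (by simpa using hsb))
      simpa using h.summable (by simp)
  smul_mem' := by
    rintro k f ⟨a, ha, hsa⟩
    refine ⟨fun n => k * a n, fun z => ?_, ?_⟩
    · simpa [mul_assoc] using (ha z).mul_left k
    · simpa [mul_pow] using hsa.mul_left (‖k‖ ^ 2)

/-- The Hardy space `H²` of the unit disc. -/
def HardyTwo : Type := hardySubmodule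

namespace HardyTwo

noncomputable instance : AddCommGroup HardyTwo := inferInstanceAs (AddCommGroup hardySubmodule)

noncomputable instance : Module ℂ HardyTwo := inferInstanceAs (Module ℂ hardySubmodule)

/-- The elements of `H²` are functions on the unit disc. -/
instance : FunLike HardyTwo 𝔻 ℂ where
  coe f := f.1
  coe_injective := Subtype.val_injective

@[ext] theorem ext {f g : HardyTwo} (h : ∀ z, f z = g z) : f = g := DFunLike.ext f g h

@[simp] theorem add_apply (f g : HardyTwo) (z : 𝔻) : (f + g) z = f z + g z := rfl

@[simp] theorem smul_apply (k : ℂ) (f : HardyTwo) (z : 𝔻) : (k • f) z = k * f z := rfl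

/-- The sequence of Taylor coefficients at the origin. -/
noncomputable def coeff (f : HardyTwo) : ℕ → ℂ := f.2.choose

theorem hasTaylorCoeffs (f : HardyTwo) : HasTaylorCoeffs f f.coeff := f.2.choose_spec.1

theorem summable_coeff (f : HardyTwo) : Summable fun n => ‖f.coeff n‖ ^ 2 := f.2.choose_spec.2

theorem coeff_eq (f : HardyTwo) {a : ℕ → ℂ} (h : HasTaylorCoeffs f a) : f.coeff = a :=
  f.hasTaylorCoeffs.unique h

/-- The linear bijection of `H²` with `ℓ²` that takes a function to its Taylor coefficients. -/
noncomputable def coeffEquiv : HardyTwo ≃ₗ[ℂ] lp (fun _ : ℕ => ℂ) 2 where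
  toFun f := ⟨f.coeff, memℓp_gen (by simpa using f.summable_coeff)⟩
  map_add' f g := by
    refine Subtype.ext (coeff_eq _ (a := fun n => f.coeff n + g.coeff n) fun z => ?_)
    simpa [add_mul] using (f.hasTaylorCoeffs z).add (g.hasTaylorCoeffs z)
  map_smul' k f := by
    refine Subtype.ext (coeff_eq _ (a := fun n => k * f.coeff n) fun z => ?_)
    simpa [mul_assoc] using (f.hasTaylorCoeffs z).mul_left k
  invFun a := ⟨fun z => ∑' n, a n * (z : ℂ) ^ n, a, fun z => by
    refine Summable.hasSum (Summable.of_norm_bounded (g := fun n => ‖a‖ * ‖(z : ℂ)‖ ^ n)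
      ((summable_geometric_of_lt_one (norm_nonneg _) z.norm_lt_one).mul_left _) fun n => ?_)
    rw [norm_mul, norm_pow]
    exact mul_le_mul_of_nonneg_right (lp.norm_apply_le_norm two_ne_zero a n) (by positivity),
    by simpa using (lp.memℓp a).summable (by simp)⟩
  left_inv f := by
    refine Subtype.ext (funext fun z => ?_)
    exact (f.hasTaylorCoeffs z).tsum_eq
  right_inv a := by
    refine Subtype.ext (coeff_eq _ fun z => ?_)
    refine Summable.hasSum (Summable.of_norm_bounded (g := fun n => ‖a‖ * ‖(z : ℂ)‖ ^ n)
      ((summable_geometric_of_lt_one (norm_nonneg _) z.norm_lt_one).mul_left _) fun n => ?_)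
    rw [norm_mul, norm_pow]
    exact mul_le_mul_of_nonneg_right (lp.norm_apply_le_norm two_ne_zero a n) (by positivity)

@[simp] theorem coeffEquiv_apply (f : HardyTwo) (n : ℕ) : coeffEquiv f n = f.coeff n := rfl

/-- The norm of `H²` is the `ℓ²` norm of the Taylor coefficients. -/
noncomputable instance : NormedAddCommGroup HardyTwo :=
  NormedAddCommGroup.induced _ _ coeffEquiv.toLinearMap coeffEquiv.injective

theorem norm_def (f : HardyTwo) : ‖f‖ = ‖coeffEquiv f‖ := rfl

/-- The inner product of `H²` is the `ℓ²` inner product of the Taylor coefficients. -/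
noncomputable instance : InnerProductSpace ℂ HardyTwo where
  norm_smul_le k f := by
    rw [norm_def, norm_def, map_smul]
    exact norm_smul_le k _
  inner f g := inner ℂ (coeffEquiv f) (coeffEquiv g)
  norm_sq_eq_re_inner f := norm_sq_eq_re_inner (𝕜 := ℂ) (coeffEquiv f)
  conj_inner_symm f g := inner_conj_symm (coeffEquiv f) (coeffEquiv g)
  add_left f g k := by rw [map_add, inner_add_left]
  smul_left f g k := by rw [map_smul, inner_smul_left]

instance : CompleteSpace HardyTwo := by
  have h : Isometry coeffEquiv := AddMonoidHomClass.isometry_of_norm coeffEquiv fun f => rfl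
  exact (completeSpace_iff_isComplete_range h.isUniformInducing).2 (by
    rw [coeffEquiv.surjective.range_eq]
    exact isComplete_univ)

theorem norm_sq_eq (f : HardyTwo) : ‖f‖ ^ 2 = ∑' n, ‖f.coeff n‖ ^ 2 := by
  have := lp.norm_rpow_eq_tsum (p := 2) (by simp) (coeffEquiv f)
  simpa [norm_def] using this

end HardyTwo

/-- The analytic Toeplitz operator `f ↦ φ f` on `H²`, for a bounded holomorphic symbol `φ`. -/
noncomputable def toeplitz (φ : 𝔻 → ℂ) (hφ : IsBoundedHolomorphic φ) :
    HardyTwo →L[ℂ] HardyTwo :=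
  LinearMap.mkContinuousOfExistsBound
    { toFun := fun f => ⟨fun z => φ z * f z, by
        obtain ⟨M, hM⟩ := hφ.2
        obtain ⟨c, hc, hs, -⟩ := f.hasTaylorCoeffs.exists_mul hφ.1 hM f.summable_coeff
        exact ⟨c, hc, hs⟩⟩
      map_add' := fun f g => HardyTwo.ext fun z => mul_add _ _ _
      map_smul' := fun k f => HardyTwo.ext fun z => mul_left_comm _ _ _ }
    (by
      obtain ⟨M, hM⟩ := hφ.2
      have hM0 : 0 ≤ M := (norm_nonneg _).trans (hM 0)
      refine ⟨M, fun f => ?_⟩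
      obtain ⟨c, hc, hs, hle⟩ := f.hasTaylorCoeffs.exists_mul hφ.1 hM f.summable_coeff
      refine le_of_sq_le_sq ?_ (by positivity)
      rw [HardyTwo.norm_sq_eq, mul_pow, HardyTwo.norm_sq_eq, HardyTwo.coeff_eq _ hc]
      exact hle)

@[simp] theorem toeplitz_apply (φ : 𝔻 → ℂ) (hφ : IsBoundedHolomorphic φ) (f : HardyTwo) (z : 𝔻) :
    toeplitz φ hφ f z = φ z * f z := rfl

/-- `X` intertwines the bounded operators `A` and `B`: `X A = B X` and `X ≠ 0`. -/
def Intertwines {H : Type*} [NormedAddCommGroup H] [InnerProductSpace ℂ H]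
    (X A B : H →L[ℂ] H) : Prop :=
  X ∘L A = B ∘L X ∧ X ≠ 0

/-- The relation `A ∝ B`: some bounded operator intertwines `A` and `B`. -/
def Intertwined {H : Type*} [NormedAddCommGroup H] [InnerProductSpace ℂ H]
    (A B : H →L[ℂ] H) : Prop :=
  ∃ X : H →L[ℂ] H, Intertwines X A B

/-- `φ` singly covers `W`: it takes some subset `V` of the disc injectively onto `W`, and `V` is
the full preimage of `W`. -/
def SinglyCovers (φ : 𝔻 → ℂ) (W : Set ℂ) : Prop :=
  ∃ V : Set 𝔻, Set.BijOn φ V W ∧ φ ⁻¹' W = V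

/-- Holomorphic self-maps of the unit disc. -/
def IsHolomorphicSelfMap (ω : 𝔻 → 𝔻) : Prop :=
  IsHolomorphic fun z => (ω z : ℂ)

/-- `X` is the weighted composition operator `C_{ω,h}`, `f ↦ h · (f ∘ ω)`. -/
def IsWeightedComposition (X : HardyTwo →L[ℂ] HardyTwo) (ω : 𝔻 → 𝔻) (h : HardyTwo) : Prop :=
  ∀ (f : HardyTwo) (z : 𝔻), X f z = h z * f (ω z)

/-!
Let `v` be a point of the disc whose image `φ v` lies in the singly covered open set `W`. Since
`φ` is injective near `v` and takes the values close to `φ v` only near `v`, the zero of `φ - φ v`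
at `v` is simple and `φ - φ v` stays away from zero elsewhere. Hence `z - v = u (φ - φ v)` with `u`
bounded and holomorphic (`SinglyCovers.exists_sub_eq_mul`).

Let `X` satisfy `X T_φ = T_ψ X`, and let `ψ z = φ v ∈ W`. Then `X ((φ - φ v) k)` vanishes at `z`
for every `k` in `H²`, so `X ((id - v) k)` does too. This determines `X` on the monomials at `z`,
and summing the Taylor series gives `X f z = X 1 z * f v` for all `f`
(`apply_eq_of_comp_toeplitz_eq`).

Fix a nonzero intertwining operator `Y` and put `ω = Y id / Y 1`, so that `ω z = v` wherever
`ψ z = φ v ∈ W` and `Y 1 z ≠ 0`. By the identity theorem `Y (id ^ n) = Y 1 * ω ^ n` as meromorphic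
functions, and for fixed `z` the left side is bounded in `n`. This forces `‖ω‖ ≤ 1`, whence the
singularities are removable (`IsHolomorphic.exists_eq_mul`), and the maximum principle gives
`‖ω‖ < 1`. The equality `ψ = φ ∘ ω`, and `X f = X 1 * (f ∘ ω)` for every intertwining `X`, hold on
an open set and so everywhere.
-/

open Filter Topology Set

/-! ### Local behaviour of injective analytic functions -/

/-- An analytic function that is injective near `v` has a simple zero of `f - f v` at `v`, in the
form of a lower bound for `f - f v`. If the zero had order `n ≥ 2`, then `f - f v` would be the
`n`-th power of an open map `u` with `u v = 0`, and the points where `u` takes the values `t` and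
`ζ t`, with `ζ` an `n`-th root of unity, would contradict injectivity. -/
theorem AnalyticAt.exists_norm_sub_le_of_injOn {f : ℂ → ℂ} {v : ℂ} {s : Set ℂ}
    (hf : AnalyticAt ℂ f v) (hs : s ∈ 𝓝 v) (hinj : InjOn f s) :
    ∃ C : ℝ, ∀ᶠ z in 𝓝 v, ‖z - v‖ ≤ C * ‖f z - f v‖ := by
  have hnc : ¬ ∀ᶠ z in 𝓝 v, f z - f v = 0 := by
    intro h
    have h1 : ∀ᶠ z in 𝓝[≠] v, False := by
      filter_upwards [nhdsWithin_le_nhds h, nhdsWithin_le_nhds hs, self_mem_nhdsWithin]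
        with z hz hzs hne
      exact hne (hinj hzs (mem_of_mem_nhds hs) (sub_eq_zero.1 hz))
    simpa using h1.exists
  obtain ⟨n, g, hg, hg0, hfg⟩ :=
    (hf.sub (analyticAt_const (v := f v))).exists_eventuallyEq_pow_smul_nonzero_iff.2 hnc
  simp only [smul_eq_mul, Pi.sub_apply] at hfg
  rcases Nat.lt_or_ge n 2 with hn | hn
  · have hn1 : n = 1 := by
      have h0 : n ≠ 0 := by
        rintro rfl
        have := hfg.self_of_nhds
        simp at this
        exact hg0 this.symm
      omega
    subst hn1
    refine ⟨2 / ‖g v‖, ?_⟩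
    have hgv : 0 < ‖g v‖ := norm_pos_iff.2 hg0
    have h2 : ∀ᶠ z in 𝓝 v, ‖g v‖ / 2 < ‖g z‖ :=
      hg.continuousAt.norm.eventually_const_lt (half_lt_self hgv)
    filter_upwards [hfg, h2] with z hz hz2
    rw [hz, pow_one, norm_mul, div_mul_eq_mul_div, le_div_iff₀ hgv]
    nlinarith [norm_nonneg (z - v)]
  · exfalso
    have hn0 : n ≠ 0 := by omega
    obtain ⟨a, ha⟩ := IsAlgClosed.exists_pow_nat_eq (g v) (Nat.pos_of_ne_zero hn0)
    have ha0 : a ≠ 0 := by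
      rintro rfl
      rw [zero_pow hn0] at ha
      exact hg0 ha.symm
    let u : ℂ → ℂ := fun z => (z - v) * (a * (g z / g v) ^ ((n : ℂ)⁻¹))
    have hu : AnalyticAt ℂ u v := by
      refine (analyticAt_id.sub analyticAt_const).mul (analyticAt_const.mul ?_)
      refine (hg.div analyticAt_const hg0).cpow analyticAt_const ?_
      simp [hg0]
    have hun : ∀ z, u z ^ n = (z - v) ^ n * g z := by
      intro z
      simp only [u]
      rw [mul_pow, mul_pow, Complex.cpow_nat_inv_pow _ hn0, ha, mul_div_cancel₀ _ hg0]
    have huv : u v = 0 := by simp [u]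
    have hfu : ∀ᶠ z in 𝓝 v, f z = f v + u z ^ n := by
      filter_upwards [hfg] with z hz
      rw [hun, ← hz]
      ring
    have hopen : 𝓝 (u v) ≤ map u (𝓝 v) := by
      refine hu.eventually_constant_or_nhds_le_map_nhds.resolve_left fun h => hnc ?_
      filter_upwards [h, hfu] with z hz hz2
      rw [hz2, hz, huv, zero_pow hn0]
      ring
    rw [huv] at hopen
    have himg : u '' (s ∩ {z | f z = f v + u z ^ n}) ∈ 𝓝 (0 : ℂ) :=
      hopen (image_mem_map (inter_mem hs hfu))
    obtain ⟨ζ, hζ⟩ : ∃ ζ : ℂ, IsPrimitiveRoot ζ n :=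
      ⟨_, Complex.isPrimitiveRoot_exp n hn0⟩
    have himg2 : ∀ᶠ t in 𝓝 (0 : ℂ), ζ * t ∈ u '' (s ∩ {z | f z = f v + u z ^ n}) := by
      have : Tendsto (fun t : ℂ => ζ * t) (𝓝 0) (𝓝 0) := by
        simpa using (continuous_const_mul ζ).tendsto 0
      exact this himg
    obtain ⟨t, ⟨⟨x, hx, hxt⟩, ⟨y, hy, hyt⟩⟩, ht⟩ :=
      (((Eventually.and himg himg2).filter_mono nhdsWithin_le_nhds).and
        (self_mem_nhdsWithin (a := (0 : ℂ)) (s := {0}ᶜ))).exists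
    have hxy : x = y := by
      refine hinj hx.1 hy.1 ?_
      rw [hx.2, hy.2, hxt, hyt, mul_pow, hζ.pow_eq_one, one_mul]
    subst hxy
    have h1 : ζ * t = 1 * t := by rw [← hyt, hxt, one_mul]
    exact hζ.ne_one (by omega) (mul_right_cancel₀ ht h1)

/-! ### Holomorphic functions on the disc -/

theorem Complex.UnitDisc.isOpenEmbedding_coe :
    Topology.IsOpenEmbedding ((↑) : 𝔻 → ℂ) :=
  Metric.isOpen_ball.isOpenEmbedding_subtypeVal

theorem Complex.UnitDisc.map_coe_nhds (z : 𝔻) : map ((↑) : 𝔻 → ℂ) (𝓝 z) = 𝓝 (z : ℂ) :=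
  Complex.UnitDisc.isOpenEmbedding_coe.map_nhds_eq z

theorem Complex.UnitDisc.mem_ball (z : 𝔻) : (z : ℂ) ∈ Metric.ball (0 : ℂ) 1 := by
  simpa using z.norm_lt_one

namespace IsHolomorphic

variable {f g : 𝔻 → ℂ}

theorem const (k : ℂ) : IsHolomorphic fun _ => k :=
  ⟨fun _ => k, differentiableOn_const k, fun _ => rfl⟩

theorem coe : IsHolomorphic fun z => (z : ℂ) := ⟨id, differentiableOn_id, fun _ => rfl⟩

theorem sub (hf : IsHolomorphic f) (hg : IsHolomorphic g) : IsHolomorphic fun z => f z - g z := by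
  obtain ⟨F, hF, hFf⟩ := hf
  obtain ⟨G, hG, hGg⟩ := hg
  exact ⟨fun z => F z - G z, hF.sub hG, fun z => by simp only [hFf, hGg]⟩

theorem mul (hf : IsHolomorphic f) (hg : IsHolomorphic g) : IsHolomorphic fun z => f z * g z := by
  obtain ⟨F, hF, hFf⟩ := hf
  obtain ⟨G, hG, hGg⟩ := hg
  exact ⟨fun z => F z * G z, hF.mul hG, fun z => by simp only [hFf, hGg]⟩

theorem pow (hf : IsHolomorphic f) (n : ℕ) : IsHolomorphic fun z => f z ^ n := by
  obtain ⟨F, hF, hFf⟩ := hf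
  exact ⟨fun z => F z ^ n, hF.pow n, fun z => by simp only [hFf]⟩

theorem comp (hf : IsHolomorphic f) {ω : 𝔻 → 𝔻} (hω : IsHolomorphicSelfMap ω) :
    IsHolomorphic fun z => f (ω z) := by
  obtain ⟨F, hF, hFf⟩ := hf
  obtain ⟨G, hG, hGω⟩ := hω
  refine ⟨fun z => F (G z), hF.comp hG fun z hz => ?_, fun z => by simp only [hGω, hFf]⟩
  have := hGω ⟨z, hz⟩
  change G z = _ at this
  rw [this]
  exact (ω ⟨z, hz⟩).mem_ball

theorem continuous (hf : IsHolomorphic f) : Continuous f := by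
  obtain ⟨F, hF, hFf⟩ := hf
  have h : f = fun z : 𝔻 => F z := funext fun z => (hFf z).symm
  rw [h]
  exact hF.continuousOn.comp_continuous Complex.UnitDisc.continuous_coe fun z => z.mem_ball

/-- The identity theorem on the disc. -/
theorem eq_of_eventuallyEq (hf : IsHolomorphic f) (hg : IsHolomorphic g) {z₀ : 𝔻}
    (h : f =ᶠ[𝓝 z₀] g) : f = g := by
  obtain ⟨F, hF, hFf⟩ := hf
  obtain ⟨G, hG, hGg⟩ := hg
  have hFG : F =ᶠ[𝓝 (z₀ : ℂ)] G := by
    rw [← z₀.map_coe_nhds]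
    refine eventually_map.2 (h.mono fun z hz => ?_)
    rw [hFf, hGg, hz]
  have := (hF.analyticOnNhd Metric.isOpen_ball).eqOn_of_preconnected_of_eventuallyEq
    (hG.analyticOnNhd Metric.isOpen_ball) (convex_ball (0 : ℂ) 1).isPreconnected z₀.mem_ball hFG
  funext z
  rw [← hFf, ← hGg, this z.mem_ball]

/-- A holomorphic function that is dominated by a constant multiple of another one is divisible by
it, with bounded quotient: the singularities of the quotient are removable. -/
theorem exists_eq_mul (hf : IsHolomorphic f) (hg : IsHolomorphic g) (hg0 : ∃ z, g z ≠ 0) {C : ℝ}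
    (hC : ∀ z, ‖f z‖ ≤ C * ‖g z‖) :
    ∃ q : 𝔻 → ℂ, IsHolomorphic q ∧ (∀ z, f z = q z * g z) ∧ ∀ z, ‖q z‖ ≤ C := by
  obtain ⟨F, hF, hFf⟩ := hf
  obtain ⟨G, hG, hGg⟩ := hg
  have hGan := hG.analyticOnNhd Metric.isOpen_ball
  have hFan := hF.analyticOnNhd Metric.isOpen_ball
  have hFG : ∀ z ∈ Metric.ball (0 : ℂ) 1, ‖F z‖ ≤ C * ‖G z‖ := by
    intro z hz
    have := hC (.mk z (mem_ball_zero_iff.1 hz))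
    rwa [← hFf, ← hGg, Complex.UnitDisc.coe_mk] at this
  have hne : ∀ c ∈ Metric.ball (0 : ℂ) 1, ∀ᶠ z in 𝓝[≠] c, G z ≠ 0 := by
    intro c hc
    refine (hGan c hc).eventually_eq_zero_or_eventually_ne_zero.resolve_left fun h => ?_
    obtain ⟨w, hw⟩ := hg0
    apply hw
    rw [← hGg]
    exact hGan.eqOn_zero_of_preconnected_of_eventuallyEq_zero
      (convex_ball (0 : ℂ) 1).isPreconnected hc h w.mem_ball
  let R : ℂ → ℂ := fun z => F z / G z
  let Q : ℂ → ℂ := fun z => limUnder (𝓝[≠] z) R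
  have hRd : ∀ z ∈ Metric.ball (0 : ℂ) 1, G z ≠ 0 → DifferentiableAt ℂ R z := fun z hz h =>
    (hFan z hz).differentiableAt.div (hGan z hz).differentiableAt h
  have hRC : ∀ z ∈ Metric.ball (0 : ℂ) 1, G z ≠ 0 → ‖R z‖ ≤ C := by
    intro z hz h
    rw [norm_div, div_le_iff₀ (norm_pos_iff.2 h)]
    exact hFG z hz
  have hQR : ∀ z ∈ Metric.ball (0 : ℂ) 1, G z ≠ 0 → Q z = R z := fun z hz h =>
    ((hRd z hz h).continuousAt.tendsto.mono_left nhdsWithin_le_nhds).limUnder_eq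
  have hball : ∀ c ∈ Metric.ball (0 : ℂ) 1, ∀ᶠ z in 𝓝[≠] c, z ∈ Metric.ball (0 : ℂ) 1 ∧ G z ≠ 0 :=
    fun c hc =>
      ((Metric.isOpen_ball.eventually_mem hc).filter_mono nhdsWithin_le_nhds).and (hne c hc)
  have hQd : ∀ c ∈ Metric.ball (0 : ℂ) 1, DifferentiableAt ℂ Q c := by
    intro c hc
    have hS : insert c {z | z ∈ Metric.ball (0 : ℂ) 1 ∧ G z ≠ 0} ∈ 𝓝 c :=
      insert_mem_nhds_iff.2 (hball c hc)
    have h1 := Complex.differentiableOn_update_limUnder_of_bddAbove (f := R) hS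
      (fun z hz => by
        have hz' := hz.1.resolve_left hz.2
        exact (hRd z hz'.1 hz'.2).differentiableWithinAt)
      ⟨C, by
        rintro _ ⟨z, hz, rfl⟩
        have hz' := hz.1.resolve_left hz.2
        exact hRC z hz'.1 hz'.2⟩
    refine (h1.differentiableAt hS).congr_of_eventuallyEq ?_
    filter_upwards [hS] with z hz
    rcases eq_or_ne z c with rfl | hzc
    · simp [Q]
    · have hz' := hz.resolve_left hzc
      rw [Function.update_of_ne hzc, hQR z hz'.1 hz'.2]
  refine ⟨fun z => Q z, ⟨Q, fun c hc => (hQd c hc).differentiableWithinAt, fun _ => rfl⟩,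
    fun z => ?_, fun z => ?_⟩
  · change f z = Q z * g z
    by_cases h : G z = 0
    · have := hFG z z.mem_ball
      rw [h, norm_zero, mul_zero, norm_le_zero_iff] at this
      rw [← hFf, ← hGg, this, h, mul_zero]
    · rw [hQR z z.mem_ball h, ← hFf, ← hGg, div_mul_cancel₀ _ h]
  · refine le_of_tendsto
      ((hQd z z.mem_ball).continuousAt.norm.tendsto.mono_left (nhdsWithin_le_nhds (s := {(z : ℂ)}ᶜ)))
      ?_
    filter_upwards [hball z z.mem_ball] with w hw
    rw [hQR w hw.1 hw.2]
    exact hRC w hw.1 hw.2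

/-- The strict form of the bound `‖f‖ ≤ 1`, by the maximum principle. -/
theorem norm_lt_one (hf : IsHolomorphic f) (h1 : ∀ z, ‖f z‖ ≤ 1) {z₀ : 𝔻} (hz₀ : ‖f z₀‖ < 1)
    (z : 𝔻) : ‖f z‖ < 1 := by
  refine (h1 z).lt_of_ne fun h => hz₀.ne ?_
  obtain ⟨F, hF, hFf⟩ := hf
  have hmax : IsMaxOn (norm ∘ F) (Metric.ball (0 : ℂ) 1) z := by
    intro w hw
    have := h1 (.mk w (mem_ball_zero_iff.1 hw))
    rw [← hFf, Complex.UnitDisc.coe_mk] at this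
    change ‖F w‖ ≤ ‖F z‖
    rw [hFf, h]
    exact this
  have := Complex.norm_eqOn_of_isPreconnected_of_isMaxOn (convex_ball (0 : ℂ) 1).isPreconnected
    Metric.isOpen_ball hF z.mem_ball hmax z₀.mem_ball
  simp only [Function.comp_apply, Function.const_apply] at this
  rw [← hFf, this, hFf, h]

end IsHolomorphic

/-! ### Singly covered values -/

theorem SinglyCovers.injOn {φ : 𝔻 → ℂ} {W : Set ℂ} (h : SinglyCovers φ W) :
    InjOn φ (φ ⁻¹' W) := by
  obtain ⟨V, hV, rfl⟩ := h
  exact hV.injOn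

/-- At a point of a singly covered open set, `φ - φ v` is bounded below by a multiple of the
distance to `v`: near `v` because the zero at `v` is simple, and away from `v` because the values
close to `φ v` are taken near `v`, hence nowhere else. -/
theorem SinglyCovers.exists_norm_sub_le {φ : 𝔻 → ℂ} (hφ : IsHolomorphic φ) {W : Set ℂ}
    (hW : IsOpen W) (hcov : SinglyCovers φ W) {v : 𝔻} (hv : φ v ∈ W) :
    ∃ C : ℝ, ∀ z : 𝔻, ‖(z : ℂ) - v‖ ≤ C * ‖φ z - φ v‖ := by
  have hpre : φ ⁻¹' W ∈ 𝓝 v := (hW.preimage hφ.continuous).mem_nhds hv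
  have hinj := hcov.injOn
  obtain ⟨F, hF, hFφ⟩ := hφ
  have hFan : AnalyticAt ℂ F v := hF.analyticOnNhd Metric.isOpen_ball v v.mem_ball
  have hs : ((↑) : 𝔻 → ℂ) '' (φ ⁻¹' W) ∈ 𝓝 (v : ℂ) := by
    rw [← v.map_coe_nhds]
    exact image_mem_map hpre
  have hFinj : InjOn F (((↑) : 𝔻 → ℂ) '' (φ ⁻¹' W)) := by
    rintro _ ⟨x, hx, rfl⟩ _ ⟨y, hy, rfl⟩ hxy
    rw [hFφ, hFφ] at hxy
    rw [hinj hx hy hxy]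
  obtain ⟨C, hC⟩ := hFan.exists_norm_sub_le_of_injOn hs hFinj
  have hopen : 𝓝 (F v) ≤ map F (𝓝 (v : ℂ)) := by
    refine hFan.eventually_constant_or_nhds_le_map_nhds.resolve_left fun h => ?_
    have h1 : ∀ᶠ z in 𝓝[≠] (v : ℂ), False := by
      filter_upwards [nhdsWithin_le_nhds h, nhdsWithin_le_nhds hs, self_mem_nhdsWithin]
        with z hz hzs hne
      exact hne (hFinj hzs (mem_of_mem_nhds hs) hz)
    simpa using h1.exists
  rw [← v.map_coe_nhds] at hC hopen
  have hN := hopen (image_mem_map (image_mem_map (eventually_map.1 hC)))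
  rw [hFφ] at hN
  obtain ⟨δ, hδ, hball⟩ := Metric.mem_nhds_iff.1 (inter_mem hN (hW.mem_nhds hv))
  refine ⟨max C (2 / δ), fun z => ?_⟩
  rcases lt_or_ge ‖φ z - φ v‖ δ with hlt | hge
  · obtain ⟨⟨_, ⟨w, hw, rfl⟩, hwz⟩, hzW⟩ := hball (mem_ball_iff_norm.2 hlt)
    rw [hFφ] at hwz
    have hwz' : w = z := hinj (show φ w ∈ W by rw [hwz]; exact hzW) hzW hwz
    subst hwz'
    have hw' : ‖(w : ℂ) - v‖ ≤ C * ‖F w - φ v‖ := hw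
    rw [hFφ] at hw'
    exact hw'.trans (mul_le_mul_of_nonneg_right (le_max_left _ _) (norm_nonneg _))
  · calc ‖(z : ℂ) - v‖ ≤ ‖(z : ℂ)‖ + ‖(v : ℂ)‖ := norm_sub_le _ _
      _ ≤ 2 := by linarith [z.norm_lt_one, v.norm_lt_one]
      _ = 2 / δ * δ := by field_simp
      _ ≤ max C (2 / δ) * ‖φ z - φ v‖ := by
        gcongr
        exact le_max_right _ _

/-- At a singly covered value, `φ - φ v` divides `z - v` in the algebra of bounded holomorphic
functions. -/
theorem SinglyCovers.exists_sub_eq_mul {φ : 𝔻 → ℂ} (hφ : IsHolomorphic φ) {W : Set ℂ}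
    (hW : IsOpen W) (hcov : SinglyCovers φ W) {v : 𝔻} (hv : φ v ∈ W) :
    ∃ u : 𝔻 → ℂ, IsBoundedHolomorphic u ∧ ∀ z : 𝔻, (z : ℂ) - v = u z * (φ z - φ v) := by
  obtain ⟨C, hC⟩ := hcov.exists_norm_sub_le hφ hW hv
  have hne : ∃ z, φ z - φ v ≠ 0 := by
    by_contra! h
    have h1 : ∀ z : 𝔻, z = v := fun z => by
      have := hC z
      rw [h z, norm_zero, mul_zero, norm_le_zero_iff, sub_eq_zero] at this
      exact Complex.UnitDisc.coe_injective this
    have h2 := (h1 (.mk (1 / 2) (by norm_num))).trans (h1 0).symm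
    have h3 := congrArg ((↑) : 𝔻 → ℂ) h2
    norm_num at h3
  obtain ⟨u, hu, hmul, hbd⟩ := (IsHolomorphic.coe.sub (.const (v : ℂ))).exists_eq_mul
    (hφ.sub (.const (φ v))) hne hC
  exact ⟨u, ⟨hu, C, hbd⟩, hmul⟩

/-! ### Evaluation and Taylor expansion in the Hardy space -/

namespace HardyTwo

theorem norm_coeff_le (f : HardyTwo) (n : ℕ) : ‖f.coeff n‖ ≤ ‖f‖ :=
  lp.norm_apply_le_norm two_ne_zero (coeffEquiv f) n

theorem norm_apply_le (f : HardyTwo) (z : 𝔻) : ‖f z‖ ≤ (1 - ‖(z : ℂ)‖)⁻¹ * ‖f‖ := by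
  have h := (hasSum_geometric_of_lt_one (norm_nonneg _) z.norm_lt_one).mul_right ‖f‖
  rw [← (f.hasTaylorCoeffs z).tsum_eq]
  refine tsum_of_norm_bounded h fun n => ?_
  rw [norm_mul, norm_pow, mul_comm]
  gcongr
  exact f.norm_coeff_le n

/-- Evaluation at a point of the disc, as a bounded functional on `H²`. -/
noncomputable def eval (z : 𝔻) : HardyTwo →L[ℂ] ℂ :=
  LinearMap.mkContinuous
    { toFun := fun f => f z
      map_add' := fun _ _ => rfl
      map_smul' := fun _ _ => rfl } (1 - ‖(z : ℂ)‖)⁻¹ fun f => f.norm_apply_le z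

@[simp] theorem eval_apply (z : 𝔻) (f : HardyTwo) : eval z f = f z := rfl

theorem isHolomorphic (f : HardyTwo) : IsHolomorphic f := by
  refine ⟨fun z => ∑' n, f.coeff n * z ^ n, fun z hz => ?_, fun z => (f.hasTaylorCoeffs z).tsum_eq⟩
  obtain ⟨r, hzr, hr⟩ := exists_between (mem_ball_zero_iff.1 hz)
  have hr0 : 0 ≤ r := (norm_nonneg z).trans hzr.le
  have h : DifferentiableOn ℂ (fun z => ∑' n, f.coeff n * z ^ n) (Metric.ball 0 r) := by
    refine Complex.differentiableOn_tsum_of_summable_norm (u := fun n => ‖f‖ * r ^ n)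
      ((summable_geometric_of_lt_one hr0 hr).mul_left _) (fun n => by fun_prop)
      Metric.isOpen_ball fun n w hw => ?_
    rw [norm_mul, norm_pow]
    gcongr
    · exact f.norm_coeff_le n
    · exact (mem_ball_zero_iff.1 hw).le
  exact (h.differentiableAt (Metric.isOpen_ball.mem_nhds
    (mem_ball_zero_iff.2 hzr))).differentiableWithinAt

/-- The function `z ↦ z ^ n`, as an element of `H²`. -/
noncomputable def monomial (n : ℕ) : HardyTwo := coeffEquiv.symm (lp.single 2 n 1)

@[simp] theorem monomial_apply (n : ℕ) (z : 𝔻) : monomial n z = (z : ℂ) ^ n := by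
  change ∑' k, lp.single (E := fun _ : ℕ => ℂ) 2 n 1 k * (z : ℂ) ^ k = _
  rw [tsum_eq_single n]
  · simp
  · intro k hk
    simp [hk]

theorem norm_monomial (n : ℕ) : ‖monomial n‖ = 1 := by
  rw [norm_def, monomial, LinearEquiv.apply_symm_apply, lp.norm_single (by norm_num), norm_one]

/-- The Taylor series of an element of `H²` converges to it in norm. -/
theorem hasSum_monomial (f : HardyTwo) : HasSum (fun n => f.coeff n • monomial n) f := by
  let e : HardyTwo ≃ₗᵢ[ℂ] lp (fun _ : ℕ => ℂ) 2 := ⟨coeffEquiv, fun _ => rfl⟩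
  have h := (lp.hasSum_single (E := fun _ : ℕ => ℂ) (p := 2) (by norm_num) (coeffEquiv f)).map
    e.symm e.symm.continuous
  have hf : e.symm (coeffEquiv f) = f := coeffEquiv.symm_apply_apply f
  rw [hf] at h
  refine h.congr_fun fun n => ?_
  change _ = coeffEquiv.symm _
  rw [monomial, ← map_smul, ← lp.single_smul]
  simp

end HardyTwo

/-! ### Intertwining operators -/

open HardyTwo

variable {φ ψ : 𝔻 → ℂ} {hφ : IsBoundedHolomorphic φ} {hψ : IsBoundedHolomorphic ψ}
  {X : HardyTwo →L[ℂ] HardyTwo} {W : Set ℂ}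

/-- At a point `z` where `ψ` takes a singly covered value `φ v`, the functional `f ↦ X f z` is a
multiple of the evaluation at `v`. Indeed it vanishes on the multiples of `φ - φ v`, thus on those
of `z - v`, which determines it on the monomials. -/
theorem apply_eq_of_comp_toeplitz_eq (hX : X ∘L toeplitz φ hφ = toeplitz ψ hψ ∘L X)
    (hW : IsOpen W) (hcov : SinglyCovers φ W) {z v : 𝔻} (hv : φ v = ψ z) (hz : ψ z ∈ W)
    (f : HardyTwo) : X f z = X (monomial 0) z * f v := by
  obtain ⟨u, hu, hmul⟩ := hcov.exists_sub_eq_mul hφ.1 hW (hv ▸ hz : φ v ∈ W)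
  have hstep : ∀ n, X (monomial (n + 1)) z = X (monomial n) z * v := by
    intro n
    set k := toeplitz u hu (monomial n)
    have h1 : monomial (n + 1) = (v : ℂ) • monomial n + (toeplitz φ hφ k - φ v • k) := by
      ext w
      have h2 : (toeplitz φ hφ k - φ v • k) w = φ w * k w - φ v * k w := rfl
      rw [add_apply, smul_apply, h2, monomial_apply, monomial_apply, toeplitz_apply,
        monomial_apply]
      linear_combination (w : ℂ) ^ n * hmul w
    have h3 : X (toeplitz φ hφ k) = toeplitz ψ hψ (X k) := DFunLike.congr_fun hX k
    rw [h1, map_add, map_sub, map_smul, map_smul, h3]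
    change v * X (monomial n) z + (ψ z * X k z - φ v * X k z) = _
    rw [hv]
    ring
  have hmon : ∀ n, X (monomial n) z = X (monomial 0) z * (v : ℂ) ^ n := by
    intro n
    induction n with
    | zero => simp
    | succ n ih => rw [hstep, ih, pow_succ, mul_assoc]
  have h1 := f.hasSum_monomial.mapL (eval z ∘L X)
  have h2 := (f.hasTaylorCoeffs v).mul_left (X (monomial 0) z)
  refine HasSum.unique h1 (h2.congr_fun fun n => ?_)
  rw [map_smul, smul_eq_mul, ContinuousLinearMap.comp_apply, eval_apply, hmon]
  ring

/-- Comparison of two numbers through the growth of their powers. -/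
theorem le_of_forall_pow_succ_le {a b K : ℝ} (hb : 0 ≤ b)
    (h : ∀ n : ℕ, a ^ (n + 1) ≤ b ^ n * K) : a ≤ b := by
  by_contra! hlt
  have ha0 : 0 < a := hb.trans_lt hlt
  have hlim : Tendsto (fun n : ℕ => (b / a) ^ n * K) atTop (𝓝 (0 * K)) :=
    (tendsto_pow_atTop_nhds_zero_of_lt_one (by positivity) ((div_lt_one ha0).2 hlt)).mul_const K
  rw [zero_mul] at hlim
  refine ha0.not_ge (ge_of_tendsto' hlim fun n => ?_)
  rw [div_pow, div_mul_eq_mul_div, le_div_iff₀ (by positivity)]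
  linarith [h n, pow_succ' a n]

theorem theorem4p2 (φ ψ : 𝔻 → ℂ) (hφ : IsBoundedHolomorphic φ) (hψ : IsBoundedHolomorphic ψ)
    (W : Set ℂ) (hW_open : IsOpen W) (hW_nonempty : W.Nonempty) (hW_sub : W ⊆ Set.range φ)
    (hW_cov : SinglyCovers φ W) (hW_meets : (W ∩ Set.range ψ).Nonempty)
    (hT : Intertwined (toeplitz φ hφ) (toeplitz ψ hψ)) :
    Set.range ψ ⊆ Set.range φ ∧
    ∃ ω : 𝔻 → 𝔻, IsHolomorphicSelfMap ω ∧ ψ = φ ∘ ω ∧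
      ∀ X : HardyTwo →L[ℂ] HardyTwo, Intertwines X (toeplitz φ hφ) (toeplitz ψ hψ) →
        ∃ h : HardyTwo, IsWeightedComposition X ω h := by
  obtain ⟨Y, hY, hY0⟩ := hT
  obtain ⟨_, hz₀, z₀, rfl⟩ := hW_meets
  have hΩ : ∀ᶠ z in 𝓝 z₀, ψ z ∈ W := (hW_open.preimage hψ.1.continuous).mem_nhds hz₀
  have hYz : ∀ z, ψ z ∈ W → ∃ v, φ v = ψ z ∧ ∀ f, Y f z = Y (monomial 0) z * f v := by
    intro z hz
    obtain ⟨v, hv⟩ := hW_sub hz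
    exact ⟨v, hv, apply_eq_of_comp_toeplitz_eq hY hW_open hW_cov hv hz⟩
  have hne : ∃ᶠ z in 𝓝 z₀, Y (monomial 0) z ≠ 0 := by
    intro h
    refine hY0 (ContinuousLinearMap.ext fun f => HardyTwo.ext fun z => ?_)
    refine congrFun ((Y f).isHolomorphic.eq_of_eventuallyEq (.const 0) (z₀ := z₀) ?_) z
    filter_upwards [h, hΩ] with w hw hwW
    obtain ⟨v, -, hv⟩ := hYz w hwW
    rw [hv f, not_not.1 hw, zero_mul]
  obtain ⟨z₁, hz₁, hz₁W⟩ := (hne.and_eventually hΩ).exists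
  have hpow : ∀ (n : ℕ) (z : 𝔻),
      Y (monomial 1) z ^ (n + 1) = Y (monomial 0) z ^ n * Y (monomial (n + 1)) z := by
    intro n
    refine congrFun (((Y _).isHolomorphic.pow _).eq_of_eventuallyEq
      (((Y _).isHolomorphic.pow n).mul (Y _).isHolomorphic) (z₀ := z₀) ?_)
    filter_upwards [hΩ] with z hz
    obtain ⟨v, -, hv⟩ := hYz z hz
    rw [hv (monomial 1), hv (monomial (n + 1)), monomial_apply, monomial_apply]
    ring
  -- The functions `Y (monomial n)` are bounded at each point, uniformly in `n`.
  have hle : ∀ z, ‖Y (monomial 1) z‖ ≤ 1 * ‖Y (monomial 0) z‖ := by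
    intro z
    rw [one_mul]
    refine le_of_forall_pow_succ_le (K := ‖eval z ∘L Y‖) (norm_nonneg _) fun n => ?_
    rw [← norm_pow, hpow, norm_mul, norm_pow]
    gcongr
    have := (eval z ∘L Y).le_opNorm (monomial (n + 1))
    rwa [norm_monomial, mul_one] at this
  obtain ⟨q, hq, hmul, hq1⟩ :=
    (Y (monomial 1)).isHolomorphic.exists_eq_mul (Y (monomial 0)).isHolomorphic ⟨z₁, hz₁⟩ hle
  have hqv : ∀ z v, Y (monomial 0) z ≠ 0 → (∀ f, Y f z = Y (monomial 0) z * f v) → q z = v := by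
    intro z v h0 hv
    have h1 := hmul z
    rw [hv (monomial 1), mul_comm, monomial_apply, pow_one] at h1
    exact (mul_right_cancel₀ h0 h1).symm
  have hq_lt : ∀ z, ‖q z‖ < 1 := by
    obtain ⟨v, -, hv⟩ := hYz z₁ hz₁W
    refine hq.norm_lt_one hq1 (z₀ := z₁) ?_
    rw [hqv z₁ v hz₁ hv]
    exact v.norm_lt_one
  let ω : 𝔻 → 𝔻 := fun z => .mk (q z) (hq_lt z)
  have hω : IsHolomorphicSelfMap ω := hq
  have hψω : ψ = φ ∘ ω := by
    refine hψ.1.eq_of_eventuallyEq (hφ.1.comp hω) (z₀ := z₁) ?_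
    filter_upwards [(hW_open.preimage hψ.1.continuous).mem_nhds hz₁W,
      (Y (monomial 0)).isHolomorphic.continuous.continuousAt.eventually_ne hz₁] with z hzW hz0
    obtain ⟨v, hvz, hv⟩ := hYz z hzW
    have : ω z = v := Complex.UnitDisc.coe_injective (hqv z v hz0 hv)
    rw [Function.comp_apply, this, hvz]
  refine ⟨?_, ω, hω, hψω, fun X hX => ⟨X (monomial 0), fun f => congrFun ?_⟩⟩
  · rw [hψω]
    exact range_comp_subset_range ω φ
  · refine (X f).isHolomorphic.eq_of_eventuallyEq
      ((X (monomial 0)).isHolomorphic.mul (f.isHolomorphic.comp hω)) (z₀ := z₀) ?_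
    filter_upwards [hΩ] with z hz
    exact apply_eq_of_comp_toeplitz_eq hX.1 hW_open hW_cov (congrFun hψω z).symm hz f
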